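/- Let $n\ge 2$ and let $S\subset\mathbb{R}^n$ be a smooth embedded hypersurface (possibly with boundary) with smooth unit normal field (Gauss map) $N:S\to\mathbb{S}^{n-1}$, such that - $S$ is strictly convex: the shape operator $\mathrm{d}N_u:T_uS\to T_uS$ is positive definite for every $u\in S$; - $N(u)\cdot N(u')\ge \tfrac12$ for all $u,u'\in S$; - $S$ is the graph $\{x+\phi(x)e : x\in U\}$ of a continuous function $\phi$ over a convex subset $U$ of a hyperplane $e^\perp$, for some unit vector $e$ with $N(u)\cdot e\ge\tfrac12$ for all $u\in S$; - $S$ has bounded curvature quotient: there is a finite $c$ with $\lambda_j(u)\le c\,\lambda_k(u')$ for all $u,u'\in S$ and $1\le j,k\le n-1$, where $\lambda_1(u),\dots,\lambda_{n-1}(u)$ are the principal curvatures of $S$ at $u$ (the eigenvalues of $\mathrm{d}N_u$). Let $Q(S)$ be the least such $c$. (This is automatic if $S$ is compact.) For $u,u'\in S$ with $u'\ne u$ let $R_uu'$ be the point $u''\in S$ with $u''\neq u'$, $(u'-u'')\cdot N(u)=0$ and $N(u)\wedge N(u')\wedge N(u'')=0$, if there is one; let $R_uu:=u$. Then there is at most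 one such point $u''$, so that $R_uu'$ is well defined whenever such a point exists. There is a constant $C>0$ depending only on $n$ such that, for all $u,u',u''\in S$ with $u''=R_uu'$, $$|u'-u''|\le C\,Q(S)^{1/2}|u-u'|\qquad\text{and}\qquad |u'-u''|\ge \frac{1}{C\,Q(S)}|u-u'|.$$ Consequently $\rho(u,u'):=|u'-R_uu'|$ is a quasi-distance on $S$: there is a constant $c>0$ depending only on $n$ and $Q(S)$ such that, for all $x,y,z\in S$, (i) $\rho(x,y)\ge 0$, with $\rho(x,y)=0$ if and only if $x=y$; (ii) $\rho(x,y)\le c\,\rho(y,x)$; (iii) $\rho(x,y)\le c\,(\rho(x,z)+\rho(y,z))$; each of these whenever the values of $\rho$ that appear in it are defined. -/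

import Mathlib

open scoped ContDiff

/-- `S` is a smooth embedded hypersurface of `ℝⁿ`, possibly with boundary, and `N` is a smooth unit
normal field (Gauss map) on it.  Near each of its points `S` is a regular level set `{F = 0}`, cut
by `{G ≥ 0}` where `G` is transversal to `F` (near an interior point one may take `G = 1`), and on
`S` the field `N` is the normalised gradient of `F`.  Only the values of `N` on `S` matter. -/
def IsOrientedHypersurface {n : ℕ} (S : Set (EuclideanSpace ℝ (Fin n)))
    (N : EuclideanSpace ℝ (Fin n) → EuclideanSpace ℝ (Fin n)) : Prop :=
  ∀ u ∈ S, ∃ (W : Set (EuclideanSpace ℝ (Fin n))) (F G : EuclideanSpace ℝ (Fin n) → ℝ),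
    IsOpen W ∧ u ∈ W ∧ ContDiffOn ℝ ∞ F W ∧ ContDiffOn ℝ ∞ G W ∧
    (∀ x ∈ W, gradient F x ≠ 0) ∧
    (G u = 0 → LinearIndependent ℝ ![gradient F u, gradient G u]) ∧
    S ∩ W = {x ∈ W | F x = 0 ∧ 0 ≤ G x} ∧
    ∀ x ∈ S ∩ W, N x = ‖gradient F x‖⁻¹ • gradient F x

/-- `A` is a differential of the Gauss map `N : S → 𝕊ⁿ⁻¹` at `u`.  Its values on the tangent space
`T_u S = N(u)^⊥` are determined by `S`, `N` and `u`, and are those of the shape operator `dN_u`;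
its other values are irrelevant and never used. -/
def IsShapeOperator {n : ℕ} (S : Set (EuclideanSpace ℝ (Fin n)))
    (N : EuclideanSpace ℝ (Fin n) → EuclideanSpace ℝ (Fin n)) (u : EuclideanSpace ℝ (Fin n))
    (A : EuclideanSpace ℝ (Fin n) →L[ℝ] EuclideanSpace ℝ (Fin n)) : Prop :=
  HasFDerivWithinAt N A S u

/-- Strict convexity: the shape operator is positive definite on `T_u S` at every point `u`. -/
def IsStrictlyConvexHypersurface {n : ℕ} (S : Set (EuclideanSpace ℝ (Fin n)))
    (N : EuclideanSpace ℝ (Fin n) → EuclideanSpace ℝ (Fin n)) : Prop :=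
  ∀ u ∈ S, ∀ A, IsShapeOperator S N u A →
    ∀ v : EuclideanSpace ℝ (Fin n), inner ℝ v (N u) = 0 → v ≠ 0 → 0 < inner ℝ (A v) v

/-- `κ` is a principal curvature of `S` at `u`: an eigenvalue of the shape operator on `T_u S`. -/
def IsPrincipalCurvature {n : ℕ} (S : Set (EuclideanSpace ℝ (Fin n)))
    (N : EuclideanSpace ℝ (Fin n) → EuclideanSpace ℝ (Fin n)) (u : EuclideanSpace ℝ (Fin n))
    (κ : ℝ) : Prop :=
  ∃ A, IsShapeOperator S N u A ∧
    ∃ v : EuclideanSpace ℝ (Fin n), inner ℝ v (N u) = 0 ∧ v ≠ 0 ∧ A v = κ • v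

/-- The constants `c` with `λ_j(u) ≤ c λ_k(u')` for all `u, u' ∈ S` and all principal curvatures
`λ_j(u)` at `u` and `λ_k(u')` at `u'`. -/
def curvatureRatioBounds {n : ℕ} (S : Set (EuclideanSpace ℝ (Fin n)))
    (N : EuclideanSpace ℝ (Fin n) → EuclideanSpace ℝ (Fin n)) : Set ℝ :=
  {c | ∀ u ∈ S, ∀ u' ∈ S, ∀ κ κ' : ℝ,
    IsPrincipalCurvature S N u κ → IsPrincipalCurvature S N u' κ' → κ ≤ c * κ'}

/-- The curvature quotient `Q(S)`: the least such constant.  (Meaningful when there is one, that is,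
when `curvatureRatioBounds S N` is nonempty.) -/
noncomputable def curvatureQuotient {n : ℕ} (S : Set (EuclideanSpace ℝ (Fin n)))
    (N : EuclideanSpace ℝ (Fin n) → EuclideanSpace ℝ (Fin n)) : ℝ :=
  sInf (curvatureRatioBounds S N)

/-- `S` is the graph of a continuous function over a convex subset `U` of a hyperplane `e^⊥`, where
the unit vector `e` lies in the cone of normals: `N(u) · e ≥ 1/2` on `S`. -/
def IsGraphOverConvex {n : ℕ} (S : Set (EuclideanSpace ℝ (Fin n)))
    (N : EuclideanSpace ℝ (Fin n) → EuclideanSpace ℝ (Fin n)) : Prop :=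
  ∃ (e : EuclideanSpace ℝ (Fin n)) (U : Set (EuclideanSpace ℝ (Fin n)))
    (φ : EuclideanSpace ℝ (Fin n) → ℝ),
    ‖e‖ = 1 ∧ (∀ u ∈ S, 1 / 2 ≤ inner ℝ (N u) e) ∧
    (∀ x ∈ U, inner ℝ x e = 0) ∧ Convex ℝ U ∧ ContinuousOn φ U ∧
    S = (fun x => x + φ x • e) '' U

/-- The relation `u'' = R_u u'`.  If `u' = u` it says `u'' = u`.  Otherwise `u'' ≠ u'` is a point of
`S` with `(u' - u'') · N(u) = 0` and `N(u) ∧ N(u') ∧ N(u'') = 0` (linear dependence). -/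
def IsReflection {n : ℕ} (S : Set (EuclideanSpace ℝ (Fin n)))
    (N : EuclideanSpace ℝ (Fin n) → EuclideanSpace ℝ (Fin n))
    (u u' u'' : EuclideanSpace ℝ (Fin n)) : Prop :=
  (u' = u ∧ u'' = u) ∨
  (u' ≠ u ∧ u'' ∈ S ∧ u'' ≠ u' ∧ inner ℝ (u' - u'') (N u) = 0 ∧
    ¬ LinearIndependent ℝ ![N u, N u', N u''])

/-- `R_u u'` is defined. -/
def ReflectionDefined {n : ℕ} (S : Set (EuclideanSpace ℝ (Fin n)))
    (N : EuclideanSpace ℝ (Fin n) → EuclideanSpace ℝ (Fin n))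
    (u u' : EuclideanSpace ℝ (Fin n)) : Prop :=
  ∃ u'', IsReflection S N u u' u''

open Classical in
/-- The point `R_u u'` where it is defined (elsewhere the value is irrelevant). -/
noncomputable def reflection {n : ℕ} (S : Set (EuclideanSpace ℝ (Fin n)))
    (N : EuclideanSpace ℝ (Fin n) → EuclideanSpace ℝ (Fin n))
    (u u' : EuclideanSpace ℝ (Fin n)) : EuclideanSpace ℝ (Fin n) :=
  if h : ReflectionDefined S N u u' then h.choose else u'

/-- `ρ(u, u') = |u' - R_u u'|`. -/
noncomputable def reflectionDist {n : ℕ} (S : Set (EuclideanSpace ℝ (Fin n)))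
    (N : EuclideanSpace ℝ (Fin n) → EuclideanSpace ℝ (Fin n))
    (u u' : EuclideanSpace ℝ (Fin n)) : ℝ :=
  ‖u' - reflection S N u u'‖

/-- `ρ`, a function defined at the pairs of points of `S` that satisfy `D`, is a quasi-distance with
constant `c`: each axiom holds whenever all the values of `ρ` in it are defined. -/
structure IsQuasiDistOn {X : Type*} (S : Set X) (D : X → X → Prop) (ρ : X → X → ℝ) (c : ℝ) :
    Prop where
  const_pos : 0 < c
  nonneg : ∀ x ∈ S, ∀ y ∈ S, D x y → 0 ≤ ρ x y
  eq_zero_iff : ∀ x ∈ S, ∀ y ∈ S, D x y → (ρ x y = 0 ↔ x = y)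
  quasi_symm : ∀ x ∈ S, ∀ y ∈ S, D x y → D y x → ρ x y ≤ c * ρ y x
  quasi_triangle : ∀ x ∈ S, ∀ y ∈ S, ∀ z ∈ S, D x y → D x z → D y z →
    ρ x y ≤ c * (ρ x z + ρ y z)

/-! Let `m` be the infimum of the principal curvatures; they all lie in `[m, Q m]`, and `m > 0`.
Integrating twice along the curves of `S` above segments of the convex set `U` traps `S` at each
point between two paraboloids: `(u - v) · N(u)` lies between constant multiples of `m |u - v|²` and
`Q m |u - v|²`, and `N` is Lipschitz with constant of order `Q m`
(`IsGraphOverConvex.height_bounds`). `IsPinched` records these bounds, and the rest follows from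
them.

Upper estimate: `u'` and `u''` have the same height below `u` in the direction `N u`, so comparing
the two paraboloids costs a factor `√Q`. Lower estimate: `N u'' = s • N u' + r • N u`, and
monotonicity of `N` forces `s < 0`. Modulo `N u` the normals at `u'` and `u''` are thus opposite, so
`|N u - N u'| ≤ 2 |N u' - N u''|`; expansion and Lipschitz bounds for `N` turn this into a bound on
points. The same sign argument gives uniqueness, and the two estimates make `ρ` comparable to
Euclidean distance. -/

/-! ### Symmetric operators and their eigenvalues. -/

section Spectral

variable {V : Type*} [NormedAddCommGroup V] [InnerProductSpace ℝ V] [FiniteDimensional ℝ V]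

/-- A symmetric operator with all eigenvalues in `[a, b]`, `0 ≤ a`, is bounded by `a` from below
and by `b` from above. -/
theorem LinearMap.IsSymmetric.bounds_of_eigenvalues {T : V →ₗ[ℝ] V} (hT : T.IsSymmetric) {a b : ℝ}
    (ha : 0 ≤ a) (hb : 0 ≤ b)
    (h : ∀ (κ : ℝ) (v : V), v ≠ 0 → T v = κ • v → a ≤ κ ∧ κ ≤ b) (v : V) :
    a * ‖v‖ ^ 2 ≤ inner ℝ (T v) v ∧ inner ℝ (T v) v ≤ b * ‖v‖ ^ 2 ∧ ‖T v‖ ≤ b * ‖v‖ := by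
  set B := hT.eigenvectorBasis rfl with hB
  have hev : ∀ i, a ≤ hT.eigenvalues rfl i ∧ hT.eigenvalues rfl i ≤ b := fun i =>
    h _ (B i) (B.orthonormal.ne_zero i) (hT.apply_eigenvectorBasis rfl i)
  have hTi : ∀ i, inner ℝ (B i) (T v) = hT.eigenvalues rfl i * inner ℝ (B i) v := by
    intro i
    rw [← hT (B i) v, hT.apply_eigenvectorBasis rfl i, inner_smul_left]
    simp [hB]
  have hn : ∀ w : V, ‖w‖ ^ 2 = ∑ i, (inner ℝ (B i) w) ^ 2 := by
    intro w
    rw [← B.sum_sq_norm_inner_right w]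
    simp
  have hi : inner ℝ (T v) v = ∑ i, hT.eigenvalues rfl i * (inner ℝ (B i) v) ^ 2 := by
    rw [← B.sum_inner_mul_inner]
    refine Finset.sum_congr rfl fun i _ => ?_
    rw [real_inner_comm, hTi]; ring
  refine ⟨?_, ?_, ?_⟩
  · rw [hn, hi, Finset.mul_sum]
    exact Finset.sum_le_sum fun i _ => mul_le_mul_of_nonneg_right (hev i).1 (sq_nonneg _)
  · rw [hn, hi, Finset.mul_sum]
    exact Finset.sum_le_sum fun i _ => mul_le_mul_of_nonneg_right (hev i).2 (sq_nonneg _)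
  · refine le_of_sq_le_sq ?_ (by positivity)
    rw [mul_pow, hn, hn, Finset.mul_sum]
    refine Finset.sum_le_sum fun i _ => ?_
    rw [hTi, mul_pow]
    have := hev i
    gcongr
    · linarith
    · exact this.2

end Spectral

/-! ### Existence and symmetry of the shape operator. -/

section Shape

variable {n : ℕ} {S : Set (EuclideanSpace ℝ (Fin n))}
  {N : EuclideanSpace ℝ (Fin n) → EuclideanSpace ℝ (Fin n)}

theorem IsOrientedHypersurface.norm_eq_one (h : IsOrientedHypersurface S N)
    {u : EuclideanSpace ℝ (Fin n)} (hu : u ∈ S) : ‖N u‖ = 1 := by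
  obtain ⟨W, F, G, -, huW, -, -, hg, -, -, hN⟩ := h u hu
  rw [hN u ⟨hu, huW⟩, norm_smul, norm_inv, norm_norm]
  exact inv_mul_cancel₀ (norm_ne_zero_iff.2 (hg u huW))

/-- The Gauss map has a differential, with values in the tangent space and symmetric there. -/
theorem IsOrientedHypersurface.exists_isShapeOperator (h : IsOrientedHypersurface S N)
    {u : EuclideanSpace ℝ (Fin n)} (hu : u ∈ S) :
    ∃ A, IsShapeOperator S N u A ∧ (∀ v, inner ℝ (A v) (N u) = 0) ∧
      ∀ v w, inner ℝ v (N u) = 0 → inner ℝ w (N u) = 0 →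
        inner ℝ (A v) w = inner ℝ v (A w) := by
  obtain ⟨W, F, G, hW, huW, hF, -, hg, -, -, hN⟩ := h u hu
  have hWn : W ∈ nhds u := hW.mem_nhds huW
  have hFu : ContDiffAt ℝ ∞ F u := hF.contDiffAt hWn
  set D := (InnerProductSpace.toDual ℝ (EuclideanSpace ℝ (Fin n))).symm with hD
  have hF' : DifferentiableAt ℝ (fderiv ℝ F) u :=
    (hFu.fderiv_right (m := 1) (by norm_cast)).differentiableAt (by norm_num)
  set H := fderiv ℝ (fderiv ℝ F) u with hH
  have hgrad : HasFDerivAt (fun x => gradient F x)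
      (D.toContinuousLinearEquiv.toContinuousLinearMap.comp H) u :=
    D.toContinuousLinearEquiv.toContinuousLinearMap.hasFDerivAt.comp u hF'.hasFDerivAt
  have hgu : gradient F u ≠ 0 := hg u huW
  have hinv : DifferentiableAt ℝ (fun x => ‖gradient F x‖⁻¹) u :=
    (hgrad.differentiableAt.norm ℝ hgu).inv (norm_ne_zero_iff.2 hgu)
  have hA : HasFDerivAt (fun x => ‖gradient F x‖⁻¹ • gradient F x) _ u :=
    hinv.hasFDerivAt.smul hgrad
  have hNu := hN u ⟨hu, huW⟩
  have hgN : gradient F u = ‖gradient F u‖ • N u := by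
    rw [hNu, smul_smul, mul_inv_cancel₀ (norm_ne_zero_iff.2 hgu), one_smul]
  refine ⟨fderiv ℝ (fun x => ‖gradient F x‖⁻¹ • gradient F x) u, ?_, ?_, ?_⟩
  · refine (hA.differentiableAt.hasFDerivAt.hasFDerivWithinAt (s := S)).congr_of_eventuallyEq ?_ hNu
    filter_upwards [mem_nhdsWithin_of_mem_nhds hWn, self_mem_nhdsWithin] with x hx hxS
    exact hN x ⟨hxS, hx⟩
  · intro v
    rw [hA.fderiv]
    -- The normalised gradient has unit length on all of `W`, not only on `S`; differentiating its
    -- square gives orthogonality to `N u`.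
    have h1 : ∀ᶠ x in nhds u, inner ℝ (‖gradient F x‖⁻¹ • gradient F x)
        (‖gradient F x‖⁻¹ • gradient F x) = (1 : ℝ) := by
      filter_upwards [hWn] with x hx
      rw [real_inner_self_eq_norm_sq, norm_smul, norm_inv, norm_norm,
        inv_mul_cancel₀ (norm_ne_zero_iff.2 (hg x hx)), one_pow]
    have h2 := (hA.inner ℝ hA).congr_of_eventuallyEq (f₁ := fun _ => (1 : ℝ))
      (h1.mono fun x hx => hx.symm)
    have h3 := congrArg (fun L => L v) (h2.unique (hasFDerivAt_const (1 : ℝ) u))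
    simp only [ContinuousLinearMap.comp_apply, ContinuousLinearMap.prod_apply,
      fderivInnerCLM_apply, zero_apply] at h3
    rw [hNu]
    rw [real_inner_comm] at h3
    linarith
  · intro v w hv hw
    rw [hA.fderiv]
    have hv' : inner ℝ v (gradient F u) = 0 := by rw [hgN, inner_smul_right, hv, mul_zero]
    have hw' : inner ℝ w (gradient F u) = 0 := by rw [hgN, inner_smul_right, hw, mul_zero]
    have hsymm : H v w = H w v :=
      ((contDiffAt_infty.1 hFu 2).isSymmSndFDerivAt (by simp)).eq v w
    have hDi : ∀ (L : EuclideanSpace ℝ (Fin n) →L[ℝ] ℝ) (x : EuclideanSpace ℝ (Fin n)),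
        inner ℝ (D L) x = L x := fun L x => InnerProductSpace.toDual_symm_apply
    -- The derivative of the scalar factor contributes a multiple of `gradient F u`, invisible to
    -- tangent vectors; what remains is a multiple of the Hessian of `F`.
    simp only [add_apply, smul_apply,
      ContinuousLinearMap.comp_apply, ContinuousLinearMap.smulRight_apply, inner_add_left,
      inner_add_right, inner_smul_left, inner_smul_right, hv', real_inner_comm w (gradient F u)]
    have e2 := hDi (H v) w
    have e3 := hDi (H w) v
    rw [real_inner_comm] at e3
    simp [e2, e3, hsymm, hw']

end Shape

/-! ### Principal curvatures and their pinching. -/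

section Curvature

variable {n : ℕ} {S : Set (EuclideanSpace ℝ (Fin n))}
  {N : EuclideanSpace ℝ (Fin n) → EuclideanSpace ℝ (Fin n)}

/-- The shape operator as a symmetric endomorphism of the tangent space. -/
theorem IsOrientedHypersurface.exists_tangent_operator (h : IsOrientedHypersurface S N)
    {u : EuclideanSpace ℝ (Fin n)} (hu : u ∈ S) :
    ∃ A, IsShapeOperator S N u A ∧ ∃ T : (ℝ ∙ N u)ᗮ →ₗ[ℝ] (ℝ ∙ N u)ᗮ,
      T.IsSymmetric ∧ ∀ v, (T v : EuclideanSpace ℝ (Fin n)) = A v := by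
  obtain ⟨A, hA, hA0, hsymm⟩ := h.exists_isShapeOperator hu
  refine ⟨A, hA, A.toLinearMap.restrict (p := (ℝ ∙ N u)ᗮ) (q := (ℝ ∙ N u)ᗮ) fun v _ =>
    Submodule.mem_orthogonal_singleton_iff_inner_left.2 (hA0 v), ?_, fun v => rfl⟩
  intro v w
  exact hsymm v w (Submodule.mem_orthogonal_singleton_iff_inner_left.1 v.2)
    (Submodule.mem_orthogonal_singleton_iff_inner_left.1 w.2)

theorem isPrincipalCurvature_of_tangent_operator {u : EuclideanSpace ℝ (Fin n)}
    {A : EuclideanSpace ℝ (Fin n) →L[ℝ] EuclideanSpace ℝ (Fin n)} (hA : IsShapeOperator S N u A)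
    {T : (ℝ ∙ N u)ᗮ →ₗ[ℝ] (ℝ ∙ N u)ᗮ} (hT : ∀ v, (T v : EuclideanSpace ℝ (Fin n)) = A v)
    {κ : ℝ} {v : (ℝ ∙ N u)ᗮ} (hv : v ≠ 0) (h : T v = κ • v) : IsPrincipalCurvature S N u κ := by
  refine ⟨A, hA, v, Submodule.mem_orthogonal_singleton_iff_inner_left.1 v.2, ?_, ?_⟩
  · simpa using hv
  · rw [← hT, h]; rfl

theorem IsOrientedHypersurface.exists_isPrincipalCurvature (h : IsOrientedHypersurface S N)
    (hn : 2 ≤ n) {u : EuclideanSpace ℝ (Fin n)} (hu : u ∈ S) :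
    ∃ κ, IsPrincipalCurvature S N u κ := by
  obtain ⟨A, hA, T, hsymm, hT⟩ := h.exists_tangent_operator hu
  have hN0 : N u ≠ 0 := norm_ne_zero_iff.1 (by rw [h.norm_eq_one hu]; exact one_ne_zero)
  -- The successor form provides an eigenvector with index `0`; this is where `2 ≤ n` enters.
  have hrank : Module.finrank ℝ (ℝ ∙ N u)ᗮ = (n - 2) + 1 := by
    have := Submodule.finrank_add_finrank_orthogonal (ℝ ∙ N u)
    rw [finrank_span_singleton hN0, finrank_euclideanSpace_fin] at this
    omega
  exact ⟨_, isPrincipalCurvature_of_tangent_operator hA hT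
    ((hsymm.eigenvectorBasis hrank).orthonormal.ne_zero 0)
    (hsymm.apply_eigenvectorBasis hrank 0)⟩

theorem IsStrictlyConvexHypersurface.principalCurvature_pos
    (h : IsStrictlyConvexHypersurface S N) {u : EuclideanSpace ℝ (Fin n)} (hu : u ∈ S) {κ : ℝ}
    (hκ : IsPrincipalCurvature S N u κ) : 0 < κ := by
  obtain ⟨A, hA, v, hv, hv0, hAv⟩ := hκ
  have := h u hu A hA v hv hv0
  rw [hAv, real_inner_smul_left, real_inner_self_eq_norm_sq] at this
  exact pos_of_mul_pos_left this (sq_nonneg _)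

/-- All principal curvatures lie in an interval `[m, Q(S) m]` with `m > 0`. -/
theorem exists_curvature_pinching (hn : 2 ≤ n) (hS : IsOrientedHypersurface S N)
    (hconv : IsStrictlyConvexHypersurface S N) (hQ : (curvatureRatioBounds S N).Nonempty)
    (hne : S.Nonempty) :
    1 ≤ curvatureQuotient S N ∧ ∃ m, 0 < m ∧ ∀ u ∈ S, ∀ κ, IsPrincipalCurvature S N u κ →
      m ≤ κ ∧ κ ≤ curvatureQuotient S N * m := by
  obtain ⟨u₀, hu₀⟩ := hne
  obtain ⟨κ₀, hκ₀⟩ := hS.exists_isPrincipalCurvature hn hu₀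
  have hκ₀pos := hconv.principalCurvature_pos hu₀ hκ₀
  set Q := curvatureQuotient S N with hQdef
  -- The infimum of the admissible constants is admissible, since each condition reads `κ / κ' ≤ c`.
  have hmem : ∀ u ∈ S, ∀ u' ∈ S, ∀ κ κ' : ℝ, IsPrincipalCurvature S N u κ →
      IsPrincipalCurvature S N u' κ' → κ ≤ Q * κ' := by
    intro u hu u' hu' κ κ' hκ hκ'
    have hpos := hconv.principalCurvature_pos hu' hκ'
    rw [← div_le_iff₀ hpos]
    exact le_csInf hQ fun c hc => (div_le_iff₀ hpos).2 (hc u hu u' hu' κ κ' hκ hκ')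
  have hQ1 : 1 ≤ Q := by
    have := hmem u₀ hu₀ u₀ hu₀ κ₀ κ₀ hκ₀ hκ₀
    exact le_of_mul_le_mul_right (by linarith) hκ₀pos
  have hQ0 : 0 < Q := by linarith
  set K : Set ℝ := {κ | ∃ u ∈ S, IsPrincipalCurvature S N u κ} with hK
  have hKne : K.Nonempty := ⟨κ₀, u₀, hu₀, hκ₀⟩
  have hlow : ∀ u ∈ S, ∀ κ, IsPrincipalCurvature S N u κ → κ / Q ≤ sInf K := by
    intro u hu κ hκ
    refine le_csInf hKne ?_
    rintro κ' ⟨u', hu', hκ'⟩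
    rw [div_le_iff₀ hQ0, mul_comm]
    exact hmem u hu u' hu' κ κ' hκ hκ'
  refine ⟨hQ1, sInf K, lt_of_lt_of_le (div_pos hκ₀pos hQ0) (hlow u₀ hu₀ κ₀ hκ₀), ?_⟩
  intro u hu κ hκ
  refine ⟨csInf_le ⟨0, ?_⟩ ⟨u, hu, hκ⟩, ?_⟩
  · rintro κ' ⟨u', hu', hκ'⟩
    exact (hconv.principalCurvature_pos hu' hκ').le
  · have := hlow u hu κ hκ
    rwa [div_le_iff₀ hQ0, mul_comm] at this

/-- Bounds on the principal curvatures bound the shape operator. -/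
theorem IsOrientedHypersurface.shape_bounds (hS : IsOrientedHypersurface S N)
    {u : EuclideanSpace ℝ (Fin n)} (hu : u ∈ S) {m M : ℝ} (hm : 0 ≤ m) (hM : 0 ≤ M)
    (h : ∀ κ, IsPrincipalCurvature S N u κ → m ≤ κ ∧ κ ≤ M) :
    ∃ A, IsShapeOperator S N u A ∧ ∀ v, inner ℝ v (N u) = 0 →
      m * ‖v‖ ^ 2 ≤ inner ℝ (A v) v ∧ inner ℝ (A v) v ≤ M * ‖v‖ ^ 2 ∧ ‖A v‖ ≤ M * ‖v‖ := by
  obtain ⟨A, hA, T, hsymm, hT⟩ := hS.exists_tangent_operator hu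
  refine ⟨A, hA, fun v hv => ?_⟩
  have := hsymm.bounds_of_eigenvalues hm hM (fun κ v hv0 hTv =>
    h κ (isPrincipalCurvature_of_tangent_operator hA hT hv0 hTv))
    ⟨v, Submodule.mem_orthogonal_singleton_iff_inner_left.2 hv⟩
  simp only [Submodule.coe_inner, Submodule.coe_norm, hT] at this
  exact this

end Curvature

/-! ### Differentiability of curves in a level set. -/

section Graph

open Asymptotics in
/-- A continuous curve `t ↦ x + t d + h(t) e` in a level set of a function `F` whose derivative
does not vanish on `e` is differentiable. -/
theorem hasDerivWithinAt_curve_of_level {E : Type*} [NormedAddCommGroup E] [NormedSpace ℝ E]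
    {F : E → ℝ} {F' : E →L[ℝ] ℝ} {x d e : E} {h : ℝ → ℝ} {s : Set ℝ} {t₀ : ℝ}
    (hF : HasFDerivAt F F' (x + t₀ • d + h t₀ • e)) (he : F' e ≠ 0)
    (hh : ContinuousWithinAt h s t₀) (h₀ : F (x + t₀ • d + h t₀ • e) = 0)
    (hlev : ∀ᶠ t in nhdsWithin t₀ s, F (x + t • d + h t • e) = 0) :
    HasDerivWithinAt (fun t => x + t • d + h t • e) (d - (F' d / F' e) • e) s t₀ := by
  -- `w` is the only candidate for the derivative: `d` corrected along `e` so that `F'` kills it.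
  -- The error `r` is a multiple of `e`.
  set γ : ℝ → E := fun t => x + t • d + h t • e with hγ
  set w : E := d - (F' d / F' e) • e with hw
  set r : ℝ → ℝ := fun t => h t - h t₀ + (t - t₀) * (F' d / F' e) with hr
  have hdiff : ∀ t, γ t - γ t₀ = (t - t₀) • w + r t • e := by
    intro t
    simp only [hγ, hw, hr, smul_sub, add_smul, sub_smul, mul_smul]
    module
  have hγc : ContinuousWithinAt γ s t₀ :=
    (continuousWithinAt_const.add (continuousWithinAt_id.smul continuousWithinAt_const)).add
      (hh.smul continuousWithinAt_const)
  have hFw : F' w = 0 := by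
    simp only [hw, map_sub, map_smul, smul_eq_mul]
    field_simp
    ring
  -- As `F` vanishes along `γ`, its linear part `F' (γ t - γ t₀) = F' e * r t` is negligible against
  -- `γ t - γ t₀`.
  have h1 : (fun t => r t) =o[nhdsWithin t₀ s] fun t => γ t - γ t₀ := by
    have h2 := hF.isLittleO.comp_tendsto hγc.tendsto
    have h3 : (fun t => F' e * r t) =o[nhdsWithin t₀ s] fun t => γ t - γ t₀ := by
      refine (h2.neg_left).congr' ?_ Filter.EventuallyEq.rfl
      filter_upwards [hlev] with t ht
      have := hdiff t
      simp only [hγ] at this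
      simp only [Function.comp, hγ, ht, h₀, this, map_add, map_smul, hFw, smul_eq_mul]
      ring
    exact (isLittleO_const_mul_left_iff he).1 h3
  have h2 : (fun t => r t • e) =o[nhdsWithin t₀ s] fun t => γ t - γ t₀ := by
    refine (IsBigO.of_bound ‖e‖ (Filter.Eventually.of_forall fun t => ?_)).trans_isLittleO h1
    rw [norm_smul, mul_comm]
  -- Bootstrap: the error is absorbed, so `γ t - γ t₀` is comparable to `(t - t₀) • w`.
  have h3 : (fun t => γ t - γ t₀) =O[nhdsWithin t₀ s] fun t => t - t₀ := by
    refine h2.right_isBigO_sub.trans ?_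
    refine IsBigO.of_bound ‖w‖ (Filter.Eventually.of_forall fun t => ?_)
    rw [hdiff, add_sub_cancel_right, norm_smul, mul_comm]
  rw [hasDerivWithinAt_iff_isLittleO]
  refine (h2.trans_isBigO h3).congr_left fun t => ?_
  rw [hdiff, add_sub_cancel_left]

end Graph

/-! ### One-sided Taylor bounds. -/

section Taylor

open Set

theorem le_of_hasDerivWithinAt_Icc_nonneg {f f' : ℝ → ℝ}
    (hf : ∀ t ∈ Icc (0 : ℝ) 1, HasDerivWithinAt f (f' t) (Icc 0 1) t)
    (h : ∀ t ∈ Icc (0 : ℝ) 1, 0 ≤ f' t) {t : ℝ} (ht : t ∈ Icc (0 : ℝ) 1) : f 0 ≤ f t := by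
  refine monotoneOn_of_hasDerivWithinAt_nonneg (f' := f') (convex_Icc 0 1)
    (fun t ht => (hf t ht).continuousWithinAt)
    (fun t ht => (hf t (interior_subset ht)).mono interior_subset)
    (fun t ht => h t (interior_subset ht)) (left_mem_Icc.2 zero_le_one) ht ht.1

/-- Second order Taylor bound from below on `[0, 1]`. -/
theorem taylor_two_lower {h g k : ℝ → ℝ} {a : ℝ}
    (hh : ∀ t ∈ Icc (0 : ℝ) 1, HasDerivWithinAt h (g t) (Icc 0 1) t)
    (hg : ∀ t ∈ Icc (0 : ℝ) 1, HasDerivWithinAt g (k t) (Icc 0 1) t)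
    (hk : ∀ t ∈ Icc (0 : ℝ) 1, a ≤ k t) : g 0 + a / 2 ≤ h 1 - h 0 := by
  have h1 : ∀ t ∈ Icc (0 : ℝ) 1, 0 ≤ g t - (g 0 + a * t) := by
    intro t ht
    have := le_of_hasDerivWithinAt_Icc_nonneg (f := fun t => g t - a * t) (f' := fun t => k t - a)
      (fun t ht => ((hg t ht).sub ((hasDerivWithinAt_id t _).const_mul a)).congr_deriv (by simp))
      (fun t ht => sub_nonneg.2 (hk t ht)) ht
    linarith
  have := le_of_hasDerivWithinAt_Icc_nonneg (f := fun t => h t - (g 0 * t + a / 2 * t ^ 2))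
    (f' := fun t => g t - (g 0 + a * t))
    (fun t ht => by
      refine ((hh t ht).sub (((hasDerivWithinAt_id t _).const_mul (g 0)).add
        (((hasDerivWithinAt_id t _).pow 2).const_mul (a / 2)))).congr_deriv ?_
      simp
      ring) h1 (right_mem_Icc.2 zero_le_one)
  linarith

/-- Second order Taylor bound from above on `[0, 1]`. -/
theorem taylor_two_upper {h g k : ℝ → ℝ} {b : ℝ}
    (hh : ∀ t ∈ Icc (0 : ℝ) 1, HasDerivWithinAt h (g t) (Icc 0 1) t)
    (hg : ∀ t ∈ Icc (0 : ℝ) 1, HasDerivWithinAt g (k t) (Icc 0 1) t)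
    (hk : ∀ t ∈ Icc (0 : ℝ) 1, k t ≤ b) : h 1 - h 0 ≤ g 0 + b / 2 := by
  have := taylor_two_lower (h := fun t => -h t) (g := fun t => -g t) (k := fun t => -k t) (a := -b)
    (fun t ht => (hh t ht).neg) (fun t ht => (hg t ht).neg) (fun t ht => neg_le_neg (hk t ht))
  linarith

end Taylor

/-! ### Slope of tangent vectors. -/

section Slope

variable {E : Type*} [NormedAddCommGroup E] [InnerProductSpace ℝ E]

/-- The steepness of a tangent vector `d + g e` when the normal is within `60°` of `e`. -/
theorem norm_tangent_bounds {d e ν : E} (he : ‖e‖ = 1) (hν : ‖ν‖ = 1) (hd : inner ℝ d e = 0)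
    (hνe : 1 / 2 ≤ inner ℝ ν e) {g : ℝ} (hg : inner ℝ (d + g • e) ν = 0) :
    ‖d‖ ≤ ‖d + g • e‖ ∧ ‖d + g • e‖ ≤ 2 * ‖d‖ := by
  have hee : inner ℝ e e = (1 : ℝ) := by rw [real_inner_self_eq_norm_sq, he, one_pow]
  have h1 : ‖d + g • e‖ ^ 2 = ‖d‖ ^ 2 + g ^ 2 := by
    rw [norm_add_sq_real, inner_smul_right, hd, norm_smul, he]
    simp
  set b : ℝ := inner ℝ ν e with hb
  have h2 : inner ℝ d (ν - b • e) = -(g * b) := by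
    rw [inner_add_left, real_inner_smul_left, real_inner_comm ν e] at hg
    rw [inner_sub_right, inner_smul_right, hd]
    linarith
  have h3 : ‖ν - b • e‖ ^ 2 = 1 - b ^ 2 := by
    rw [norm_sub_sq_real, inner_smul_right, ← hb, norm_smul, he, hν, mul_one, Real.norm_eq_abs,
      sq_abs]
    ring
  have h4 : (g * b) ^ 2 ≤ ‖d‖ ^ 2 * (1 - b ^ 2) := by
    have := abs_real_inner_le_norm d (ν - b • e)
    rw [h2, abs_neg] at this
    rw [← h3, ← mul_pow, ← sq_abs]
    exact pow_le_pow_left₀ (abs_nonneg _) this 2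
  -- From `b ≥ 1/2`, `(1 - b²) / b² ≤ 3 = tan² 60°`.
  have h5 : g ^ 2 ≤ 3 * ‖d‖ ^ 2 := by
    nlinarith [sq_nonneg g, sq_nonneg ‖d‖, mul_nonneg (sq_nonneg g) (by nlinarith : 0 ≤ b ^ 2 - 1/4),
      mul_nonneg (sq_nonneg ‖d‖) (by nlinarith : 0 ≤ b ^ 2 - 1/4)]
  constructor
  · exact le_of_sq_le_sq (by nlinarith [sq_nonneg g]) (norm_nonneg _)
  · exact le_of_sq_le_sq (by nlinarith) (by positivity)

end Slope

/-! ### Paraboloid bounds and the Lipschitz Gauss map. -/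

section Estimates

open Set

variable {n : ℕ} {S : Set (EuclideanSpace ℝ (Fin n))}
  {N : EuclideanSpace ℝ (Fin n) → EuclideanSpace ℝ (Fin n)}

/-- A continuous planar curve in `S` is differentiable and tangent to `S`. -/
theorem IsOrientedHypersurface.hasDerivWithinAt_curve (hS : IsOrientedHypersurface S N)
    {x d e : EuclideanSpace ℝ (Fin n)} {h : ℝ → ℝ} {s : Set ℝ} {t₀ : ℝ} (ht₀ : t₀ ∈ s)
    (hh : ContinuousWithinAt h s t₀) (hmem : ∀ t ∈ s, x + t • d + h t • e ∈ S)
    (he : inner ℝ (N (x + t₀ • d + h t₀ • e)) e ≠ 0) :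
    HasDerivWithinAt (fun t => x + t • d + h t • e)
      (d - (inner ℝ (N (x + t₀ • d + h t₀ • e)) d / inner ℝ (N (x + t₀ • d + h t₀ • e)) e) • e)
      s t₀ := by
  obtain ⟨W, F, G, hW, huW, hF, -, hg, -, hSW, hN⟩ := hS _ (hmem t₀ ht₀)
  have hWn := hW.mem_nhds huW
  set p := x + t₀ • d + h t₀ • e with hp
  have hFd : DifferentiableAt ℝ F p := (hF.contDiffAt hWn).differentiableAt (by norm_num)
  have hg0 : ‖gradient F p‖⁻¹ ≠ 0 := inv_ne_zero (norm_ne_zero_iff.2 (hg p huW))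
  have hzero : ∀ y ∈ S, y ∈ W → F y = 0 := fun y hy hyW => (hSW.subset ⟨hy, hyW⟩).2.1
  have hfd : ∀ v, fderiv ℝ F p v = inner ℝ (gradient F p) v := fun v =>
    (InnerProductSpace.toDual_symm_apply).symm
  have hc : ContinuousWithinAt (fun t => x + t • d + h t • e) s t₀ :=
    (continuousWithinAt_const.add (continuousWithinAt_id.smul continuousWithinAt_const)).add
      (hh.smul continuousWithinAt_const)
  rw [hN p ⟨hmem t₀ ht₀, huW⟩, real_inner_smul_left] at he
  rw [hN p ⟨hmem t₀ ht₀, huW⟩, real_inner_smul_left, real_inner_smul_left,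
    mul_div_mul_left _ _ hg0, ← hfd, ← hfd]
  refine hasDerivWithinAt_curve_of_level hFd.hasFDerivAt ?_ hh (hzero p (hmem t₀ ht₀) huW) ?_
  · rw [hfd]
    exact right_ne_zero_of_mul he
  · filter_upwards [hc.preimage_mem_nhdsWithin hWn, self_mem_nhdsWithin] with t ht hts
    exact hzero _ (hmem t hts) ht

/-- If the principal curvatures lie in `[m, M]`, then `S` lies between two paraboloids at each of
its points, and the Gauss map is Lipschitz. -/
theorem IsGraphOverConvex.height_bounds (hgr : IsGraphOverConvex S N)
    (hS : IsOrientedHypersurface S N) {m M : ℝ} (hm : 0 ≤ m) (hM : 0 ≤ M)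
    (hκ : ∀ u ∈ S, ∀ κ, IsPrincipalCurvature S N u κ → m ≤ κ ∧ κ ≤ M)
    {u v : EuclideanSpace ℝ (Fin n)} (hu : u ∈ S) (hv : v ∈ S) :
    m / 16 * ‖u - v‖ ^ 2 ≤ inner ℝ (u - v) (N u) ∧
      inner ℝ (u - v) (N u) ≤ 4 * M * ‖u - v‖ ^ 2 ∧ ‖N u - N v‖ ≤ 2 * M * ‖u - v‖ := by
  obtain ⟨e, U, φ, he, hNe, hUe, hU, hφ, rfl⟩ := hgr
  obtain ⟨x, hx, rfl⟩ := hu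
  obtain ⟨y, hy, rfl⟩ := hv
  set S := (fun x => x + φ x • e) '' U with hSdef
  have hee : inner ℝ e e = (1 : ℝ) := by rw [real_inner_self_eq_norm_sq, he, one_pow]
  set d := y - x with hd
  have hde : inner ℝ d e = 0 := by rw [hd, inner_sub_left, hUe x hx, hUe y hy, sub_zero]
  set h : ℝ → ℝ := fun t => φ (x + t • d) with hh
  set γ : ℝ → EuclideanSpace ℝ (Fin n) := fun t => x + t • d + h t • e with hγ
  have hUm : ∀ t ∈ Icc (0 : ℝ) 1, x + t • d ∈ U := fun t ht => by
    rw [hd]; exact hU.add_smul_sub_mem hx hy ht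
  have hmem : ∀ t ∈ Icc (0 : ℝ) 1, γ t ∈ S := fun t ht => ⟨_, hUm t ht, rfl⟩
  have hNpos : ∀ t ∈ Icc (0 : ℝ) 1, 1 / 2 ≤ inner ℝ (N (γ t)) e := fun t ht => hNe _ (hmem t ht)
  have hNne : ∀ t ∈ Icc (0 : ℝ) 1, inner ℝ (N (γ t)) e ≠ 0 := fun t ht => by
    have := hNpos t ht
    linarith
  have hNle : ∀ t ∈ Icc (0 : ℝ) 1, inner ℝ (N (γ t)) e ≤ 1 := fun t ht => by
    have := real_inner_le_norm (N (γ t)) e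
    rwa [he, hS.norm_eq_one (hmem t ht), one_mul] at this
  have hhc : ContinuousOn h (Icc 0 1) := hφ.comp (by fun_prop) hUm
  set g : ℝ → ℝ := fun t => -(inner ℝ (N (γ t)) d / inner ℝ (N (γ t)) e) with hgdef
  set γ' : ℝ → EuclideanSpace ℝ (Fin n) := fun t => d + g t • e with hγ'def
  have hγ' : ∀ t ∈ Icc (0 : ℝ) 1, HasDerivWithinAt γ (γ' t) (Icc 0 1) t := fun t ht => by
    refine (hS.hasDerivWithinAt_curve ht (hhc t ht) hmem (hNne t ht)).congr_deriv ?_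
    simp only [hγ'def, hgdef, hγ, neg_smul, sub_eq_add_neg]
  have htan : ∀ t ∈ Icc (0 : ℝ) 1, inner ℝ (γ' t) (N (γ t)) = 0 := fun t ht => by
    simp only [hγ'def, hgdef]
    rw [inner_add_left, real_inner_smul_left, real_inner_comm _ d, real_inner_comm _ e, neg_mul,
      div_mul_cancel₀ _ (hNne t ht), add_neg_cancel]
  have hγn : ∀ t ∈ Icc (0 : ℝ) 1, ‖d‖ ≤ ‖γ' t‖ ∧ ‖γ' t‖ ≤ 2 * ‖d‖ := fun t ht =>
    norm_tangent_bounds he (hS.norm_eq_one (hmem t ht)) hde (hNpos t ht) (htan t ht)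
  choose! A hA hAb using fun t (ht : t ∈ Icc (0 : ℝ) 1) =>
    hS.shape_bounds (hmem t ht) hm hM (hκ _ (hmem t ht))
  have hN' : ∀ t ∈ Icc (0 : ℝ) 1,
      HasDerivWithinAt (fun t => N (γ t)) (A t (γ' t)) (Icc 0 1) t := fun t ht =>
    (hA t ht).comp_hasDerivWithinAt t (hγ' t ht) hmem
  have hh' : ∀ t ∈ Icc (0 : ℝ) 1, HasDerivWithinAt h (g t) (Icc 0 1) t := fun t ht => by
    have h1 := (hγ' t ht).inner ℝ (hasDerivWithinAt_const t (Icc (0 : ℝ) 1) e)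
    have h2 : ∀ t, inner ℝ (γ t) e = h t := fun t => by
      simp only [hγ]
      rw [inner_add_left, inner_add_left, real_inner_smul_left, real_inner_smul_left, hUe x hx,
        hde, hee]
      ring
    simp only [h2] at h1
    refine h1.congr_deriv ?_
    simp only [hγ'def]
    rw [inner_zero_right, inner_add_left, real_inner_smul_left, hde, hee]
    ring
  -- Since `γ' = d + g • e`, the two terms of the quotient rule combine into the second fundamental
  -- form of `γ'`.
  have hg' : ∀ t ∈ Icc (0 : ℝ) 1,
      HasDerivWithinAt g (-(inner ℝ (A t (γ' t)) (γ' t) / inner ℝ (N (γ t)) e)) (Icc 0 1) t :=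
    fun t ht => by
      have h1 := (hN' t ht).inner ℝ (hasDerivWithinAt_const t (Icc (0 : ℝ) 1) d)
      have h2 := (hN' t ht).inner ℝ (hasDerivWithinAt_const t (Icc (0 : ℝ) 1) e)
      refine (h1.div h2 (hNne t ht)).neg.congr_deriv ?_
      have h3 : inner ℝ (A t (γ' t)) (γ' t) =
          inner ℝ (A t (γ' t)) d + g t * inner ℝ (A t (γ' t)) e := by
        rw [← inner_smul_right, ← inner_add_right]
      have hne := hNne t ht
      rw [h3, inner_zero_right]
      simp only [hgdef]
      field_simp
      ring
  -- In `8 = 4 * 2`, the `4` comes from `‖γ'‖ ≤ 2 ‖d‖` and the `2` from `N · e ≥ 1/2`.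
  have hk : ∀ t ∈ Icc (0 : ℝ) 1, m * ‖d‖ ^ 2 ≤ inner ℝ (A t (γ' t)) (γ' t) / inner ℝ (N (γ t)) e ∧
      inner ℝ (A t (γ' t)) (γ' t) / inner ℝ (N (γ t)) e ≤ 8 * M * ‖d‖ ^ 2 := fun t ht => by
    obtain ⟨h1, h2, -⟩ := hAb t ht _ (htan t ht)
    obtain ⟨h3, h4⟩ := hγn t ht
    have h5 := hNpos t ht
    have h6 := hNle t ht
    have h7 : ‖d‖ ^ 2 ≤ ‖γ' t‖ ^ 2 := by gcongr
    have h8 : ‖γ' t‖ ^ 2 ≤ 4 * ‖d‖ ^ 2 := by nlinarith [norm_nonneg (γ' t)]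
    have h9 : m * ‖d‖ ^ 2 ≤ m * ‖γ' t‖ ^ 2 := by gcongr
    have h10 : M * ‖γ' t‖ ^ 2 ≤ M * (4 * ‖d‖ ^ 2) := by gcongr
    have h11 : 0 ≤ m * ‖d‖ ^ 2 := by positivity
    have h12 : 0 ≤ M * ‖d‖ ^ 2 := by positivity
    rw [le_div_iff₀ (by linarith), div_le_iff₀ (by linarith)]
    constructor
    · nlinarith
    · nlinarith
  have hlow := taylor_two_lower (a := -(8 * M * ‖d‖ ^ 2)) hh' hg' fun t ht =>
    neg_le_neg (hk t ht).2
  have hupp := taylor_two_upper (b := -(m * ‖d‖ ^ 2)) hh' hg' fun t ht => neg_le_neg (hk t ht).1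
  have h01 : (0 : ℝ) ∈ Icc (0 : ℝ) 1 := left_mem_Icc.2 zero_le_one
  have hγ0 : γ 0 = x + φ x • e := by simp [hγ, hh]
  have hγ1 : γ 1 = y + φ y • e := by simp [hγ, hh, hd]
  have hdiff : γ 0 - γ 1 = -(d + (h 1 - h 0) • e) := by
    simp only [hγ]
    module
  have hlen : ‖γ 1 - γ 0‖ ≤ 2 * ‖d‖ :=
    norm_image_sub_le_of_norm_deriv_le_segment_01' hγ' fun t ht =>
      (hγn t (Ico_subset_Icc_self ht)).2
  have hlen' : ‖d‖ ^ 2 ≤ ‖γ 1 - γ 0‖ ^ 2 := by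
    rw [← norm_neg (γ 1 - γ 0), neg_sub, hdiff, norm_neg, norm_add_sq_real, inner_smul_right, hde]
    nlinarith [sq_nonneg ‖(h 1 - h 0) • e‖]
  have hlip : ‖N (γ 1) - N (γ 0)‖ ≤ 2 * M * ‖d‖ := by
    refine norm_image_sub_le_of_norm_deriv_le_segment_01' hN' fun t ht => ?_
    have ht := Ico_subset_Icc_self ht
    refine (hAb t ht _ (htan t ht)).2.2.trans ?_
    have := mul_le_mul_of_nonneg_left (hγn t ht).2 hM
    linarith
  -- Tangency at `0` eliminates `d`, leaving the gap between tangent line and graph, times `N · e`.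
  have hheight : inner ℝ (γ 0 - γ 1) (N (γ 0)) =
      (g 0 - (h 1 - h 0)) * inner ℝ (N (γ 0)) e := by
    have h1 := htan 0 h01
    simp only [hγ'def] at h1
    rw [inner_add_left, real_inner_smul_left] at h1
    rw [hdiff, inner_neg_left, inner_add_left, real_inner_smul_left, real_inner_comm _ e]
    rw [real_inner_comm _ e] at h1
    linarith
  have hb1 := hNpos 0 h01
  have hb2 := hNle 0 h01
  beta_reduce
  rw [← hγ0, ← hγ1, norm_sub_rev (γ 0), norm_sub_rev (N (γ 0)), hheight]
  have hlen2 : ‖γ 1 - γ 0‖ ^ 2 ≤ 4 * ‖d‖ ^ 2 := by nlinarith [norm_nonneg (γ 1 - γ 0)]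
  have hmlen := mul_le_mul_of_nonneg_left hlen2 hm
  have hMlen := mul_le_mul_of_nonneg_left hlen' hM
  have hm0 : 0 ≤ m * ‖d‖ ^ 2 := by positivity
  -- `1/16` is `1/2` (Taylor) times `1/2` (`N · e`) times `1/4` (`‖γ 1 - γ 0‖² ≤ 4 ‖d‖²`); `4` is
  -- half of `8`.
  refine ⟨?_, ?_, hlip.trans ?_⟩
  · nlinarith
  · nlinarith
  · have := le_of_sq_le_sq hlen' (norm_nonneg _)
    gcongr

end Estimates

/-! ### Linear algebra of coplanar unit normals. -/

section Normals

variable {E : Type*} [NormedAddCommGroup E] [InnerProductSpace ℝ E]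

theorem smul_ne_of_unit_of_inner_pos {ν a : E} (hν : ‖ν‖ = 1) (ha : ‖a‖ = 1)
    (h : 1 / 2 ≤ inner ℝ ν a) (hne : a ≠ ν) (c : ℝ) : a ≠ c • ν := by
  rintro rfl
  rw [inner_smul_right, real_inner_self_eq_norm_sq, hν, one_pow, mul_one] at h
  rw [norm_smul, hν, mul_one, Real.norm_eq_abs, abs_of_nonneg (by linarith)] at ha
  exact hne (by rw [ha, one_smul])

theorem exists_eq_smul_add_smul_of_not_linearIndependent {ν a b : E} (hν : ν ≠ 0)
    (ha : ∀ c : ℝ, a ≠ c • ν)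
    (h : ¬ LinearIndependent ℝ ![ν, a, b]) : ∃ s r : ℝ, b = s • a + r • ν := by
  obtain ⟨g, hg, i, hi⟩ := Fintype.not_linearIndependent_iff.1 h
  rw [Fin.sum_univ_three] at hg
  simp only [Matrix.cons_val_zero, Matrix.cons_val_one, Matrix.cons_val] at hg
  have key : ∀ (x y : ℝ) (z : E), x • ν + y • z = 0 → y ≠ 0 → z = (-(y⁻¹ * x)) • ν := by
    intro x y z hz hy
    rw [neg_smul, mul_smul, ← smul_neg, ← eq_neg_of_add_eq_zero_right hz, inv_smul_smul₀ hy]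
  have h2 : g 2 ≠ 0 := by
    intro h2
    rw [h2, zero_smul, add_zero] at hg
    by_cases h1 : g 1 = 0
    · rw [h1, zero_smul, add_zero] at hg
      have h0 := (smul_eq_zero.1 hg).resolve_right hν
      fin_cases i <;> simp_all
    · exact ha _ (key _ _ _ hg h1)
  refine ⟨-((g 2)⁻¹ * g 1), -((g 2)⁻¹ * g 0), ?_⟩
  have h3 : b = (g 2)⁻¹ • (g 2 • b) := (inv_smul_smul₀ h2 b).symm
  rw [eq_neg_of_add_eq_zero_right hg] at h3
  rw [h3]
  module

/-- If the components of `a` and `s a + r ν` orthogonal to `ν` point in opposite directions, these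
vectors are at least as far apart as `a` and `ν`, up to a constant. -/
theorem norm_sub_le_two_mul_of_opposite {ν a : E} (hν : ‖ν‖ = 1) (ha : ‖a‖ = 1)
    (h : 1 / 2 ≤ inner ℝ ν a) {s r : ℝ} (hs : s ≤ 0) :
    ‖ν - a‖ ≤ 2 * ‖a - (s • a + r • ν)‖ := by
  have hα : inner ℝ ν a ≤ (1 : ℝ) := by
    simpa [hν, ha] using real_inner_le_norm ν a
  have h1 : ‖ν - a‖ ^ 2 = 2 - 2 * inner ℝ ν a := by
    rw [norm_sub_sq_real, hν, ha]; ring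
  have h2 : ‖a - (s • a + r • ν)‖ ^ 2 =
      (1 - s) ^ 2 - 2 * ((1 - s) * r * inner ℝ ν a) + r ^ 2 := by
    have : a - (s • a + r • ν) = (1 - s) • a - r • ν := by module
    rw [this, norm_sub_sq_real, norm_smul, norm_smul, hν, ha, inner_smul_right,
      real_inner_smul_left, real_inner_comm, mul_one, mul_one, Real.norm_eq_abs, Real.norm_eq_abs,
      sq_abs, sq_abs]
    ring
  refine le_of_sq_le_sq ?_ (by positivity)
  rw [mul_pow, h1, h2]
  set α : ℝ := inner ℝ ν a
  -- `1 - α²` is the squared distance from `a` to the line `ℝν`; it is at least `1 - α` because `α ≥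
  -- 0`.
  have h3 : 1 - α ^ 2 ≤ (1 - s) ^ 2 * (1 - α ^ 2) :=
    le_mul_of_one_le_left (by nlinarith) (by nlinarith)
  nlinarith [sq_nonneg (r - (1 - s) * α)]

end Normals

/-! ### Reflections and the quasi-distance. -/

section Reflection

variable {n : ℕ} {S : Set (EuclideanSpace ℝ (Fin n))}
  {N : EuclideanSpace ℝ (Fin n) → EuclideanSpace ℝ (Fin n)}

/-- `S` lies between paraboloids with curvatures comparable to `m` and `Q m` at each of its points,
its Gauss map is Lipschitz, and its normals are within `60°` of each other. -/
structure IsPinched (S : Set (EuclideanSpace ℝ (Fin n)))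
    (N : EuclideanSpace ℝ (Fin n) → EuclideanSpace ℝ (Fin n)) (m Q : ℝ) : Prop where
  pos : 0 < m
  one_le : 1 ≤ Q
  norm_eq_one : ∀ u ∈ S, ‖N u‖ = 1
  half_le_inner : ∀ u ∈ S, ∀ v ∈ S, 1 / 2 ≤ inner ℝ (N u) (N v)
  le_height : ∀ u ∈ S, ∀ v ∈ S, m / 16 * ‖u - v‖ ^ 2 ≤ inner ℝ (u - v) (N u)
  height_le : ∀ u ∈ S, ∀ v ∈ S, inner ℝ (u - v) (N u) ≤ 4 * (Q * m) * ‖u - v‖ ^ 2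
  lipschitz : ∀ u ∈ S, ∀ v ∈ S, ‖N u - N v‖ ≤ 2 * (Q * m) * ‖u - v‖

namespace IsPinched

variable {m Q : ℝ} {u u' u'' v w : EuclideanSpace ℝ (Fin n)}

theorem height_pos (h : IsPinched S N m Q) (hu : u ∈ S) (hv : v ∈ S) (hne : u ≠ v) :
    0 < inner ℝ (u - v) (N u) := by
  have h1 := h.pos
  have h2 : 0 < ‖u - v‖ := norm_sub_pos_iff.2 hne
  exact lt_of_lt_of_le (by positivity) (h.le_height u hu v hv)

/-- Adding the lower height bounds at `u` and at `v` gives strong monotonicity of `N`;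
Cauchy–Schwarz finishes. -/
theorem norm_sub_le_norm_normal_sub (h : IsPinched S N m Q) (hu : u ∈ S) (hv : v ∈ S) :
    m / 8 * ‖u - v‖ ≤ ‖N u - N v‖ := by
  rcases eq_or_ne u v with rfl | hne
  · simp
  have h1 := h.le_height u hu v hv
  have h2 := h.le_height v hv u hu
  have h3 := real_inner_le_norm (u - v) (N u - N v)
  rw [← neg_sub u v, inner_neg_left, norm_neg] at h2
  rw [inner_sub_right] at h3
  have h4 : 0 < ‖u - v‖ := norm_sub_pos_iff.2 hne
  refine le_of_mul_le_mul_left ?_ h4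
  nlinarith

theorem normal_ne (h : IsPinched S N m Q) (hu : u ∈ S) (hv : v ∈ S) (hne : u ≠ v) :
    N u ≠ N v := by
  intro heq
  have h1 := h.norm_sub_le_norm_normal_sub hu hv
  have h2 : 0 < ‖u - v‖ := norm_sub_pos_iff.2 hne
  have h3 := h.pos
  rw [heq, sub_self, norm_zero] at h1
  have : 0 < m / 8 * ‖u - v‖ := by positivity
  linarith

/-- Two points of the same slice whose normals, projected to the slice, point in the same direction
are equal. -/
theorem eq_of_same_direction (h : IsPinched S N m Q) (hv : v ∈ S) (hw : w ∈ S)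
    (hslice : inner ℝ (v - w) (N u) = 0) {s r : ℝ} (hs : 0 ≤ s)
    (hN : N w = s • N v + r • N u) : v = w := by
  by_contra hne
  have h1 := h.height_pos hv hw hne
  -- Within the slice, `(v - w) · N w = s (v - w) · N v ≥ 0`, whereas strict convexity at `w` makes
  -- it negative.
  have h2 := h.height_pos hw hv (Ne.symm hne)
  rw [← neg_sub v w, inner_neg_left, hN, inner_add_right, inner_smul_right, inner_smul_right,
    hslice] at h2
  have := mul_nonneg hs h1.le
  linarith

theorem exists_normal_eq (h : IsPinched S N m Q) (hu : u ∈ S) (hu' : u' ∈ S) (hne : u' ≠ u)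
    (hR : IsReflection S N u u' u'') :
    u'' ∈ S ∧ inner ℝ (u' - u'') (N u) = 0 ∧
      ∃ s r : ℝ, s < 0 ∧ N u'' = s • N u' + r • N u := by
  obtain ⟨rfl, -⟩ | ⟨-, hu'', hne', hslice, hdep⟩ := hR
  · exact absurd rfl hne
  have hind : ∀ c : ℝ, N u' ≠ c • N u :=
    smul_ne_of_unit_of_inner_pos (h.norm_eq_one u hu) (h.norm_eq_one u' hu')
      (h.half_le_inner u hu u' hu') (h.normal_ne hu' hu hne)
  have hN0 : N u ≠ 0 := norm_ne_zero_iff.1 (by rw [h.norm_eq_one u hu]; exact one_ne_zero)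
  obtain ⟨s, r, hN⟩ := exists_eq_smul_add_smul_of_not_linearIndependent hN0 hind hdep
  refine ⟨hu'', hslice, s, r, ?_, hN⟩
  by_contra hs
  exact hne' (h.eq_of_same_direction hu' hu'' hslice (not_lt.1 hs) hN).symm

theorem reflection_unique (h : IsPinched S N m Q) (hu : u ∈ S) (hu' : u' ∈ S)
    (hv : IsReflection S N u u' v) (hw : IsReflection S N u u' w) : v = w := by
  by_cases hne : u' = u
  · obtain ⟨-, rfl⟩ | ⟨h1, -⟩ := hv
    · obtain ⟨-, rfl⟩ | ⟨h1, -⟩ := hw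
      · rfl
      · exact absurd hne h1
    · exact absurd hne h1
  obtain ⟨hvS, hv0, s, r, hs, hNv⟩ := h.exists_normal_eq hu hu' hne hv
  obtain ⟨hwS, hw0, s', r', hs', hNw⟩ := h.exists_normal_eq hu hu' hne hw
  -- Both coefficients of `N u'` are negative, so `N w` is a nonnegative multiple of `N v` modulo `N
  -- u`.
  refine h.eq_of_same_direction (u := u) hvS hwS ?_ (div_nonneg_of_nonpos hs'.le hs.le)
    (r := r' - s' / s * r) ?_
  · rw [inner_sub_left] at hv0 hw0 ⊢
    linarith
  · rw [hNv, hNw, smul_add, smul_smul, smul_smul, div_mul_cancel₀ _ hs.ne]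
    module

theorem norm_sub_reflection_le (h : IsPinched S N m Q) (hu : u ∈ S) (hu' : u' ∈ S)
    (hR : IsReflection S N u u' u'') : ‖u' - u''‖ ≤ 9 * √Q * ‖u - u'‖ := by
  by_cases hne : u' = u
  · obtain ⟨rfl, rfl⟩ | ⟨h1, -⟩ := hR
    · simp
    · exact absurd hne h1
  obtain ⟨hu'', hslice, -⟩ := h.exists_normal_eq hu hu' hne hR
  have h1 := h.le_height u hu u'' hu''
  have h2 := h.height_le u hu u' hu'
  have h3 : inner ℝ (u - u'') (N u) = inner ℝ (u - u') (N u) := by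
    rw [← sub_add_sub_cancel u u' u'', inner_add_left, hslice, add_zero]
  have hQ := h.one_le
  have hsq : √Q ^ 2 = Q := Real.sq_sqrt (by linarith)
  -- `64 Q = 4 Q / (1/16)`, the ratio of the two paraboloid constants.
  have h4 : ‖u - u''‖ ≤ 8 * √Q * ‖u - u'‖ := by
    refine le_of_sq_le_sq ?_ (by positivity)
    rw [mul_pow, mul_pow, hsq]
    refine le_of_mul_le_mul_left ?_ h.pos
    linarith
  have h5 : ‖u' - u''‖ ≤ ‖u - u'‖ + ‖u - u''‖ := by
    rw [norm_sub_rev u u']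
    exact norm_sub_le_norm_sub_add_norm_sub u' u u''
  have h6 : 1 * ‖u - u'‖ ≤ √Q * ‖u - u'‖ :=
    mul_le_mul_of_nonneg_right (Real.one_le_sqrt.2 hQ) (norm_nonneg _)
  linarith

theorem norm_sub_le_reflection (h : IsPinched S N m Q) (hu : u ∈ S) (hu' : u' ∈ S)
    (hR : IsReflection S N u u' u'') : ‖u - u'‖ ≤ 32 * Q * ‖u' - u''‖ := by
  by_cases hne : u' = u
  · obtain ⟨rfl, rfl⟩ | ⟨h1, -⟩ := hR
    · simp
    · exact absurd hne h1
  obtain ⟨hu'', -, s, r, hs, hN⟩ := h.exists_normal_eq hu hu' hne hR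
  have h1 := norm_sub_le_two_mul_of_opposite (h.norm_eq_one u hu) (h.norm_eq_one u' hu')
    (h.half_le_inner u hu u' hu') (r := r) hs.le
  rw [← hN] at h1
  have h2 := h.norm_sub_le_norm_normal_sub hu hu'
  have h3 := h.lipschitz u' hu' u'' hu''
  -- The chain is `m/8 |u - u'| ≤ |N u - N u'| ≤ 2 |N u' - N u''| ≤ 4 Q m |u' - u''|`.
  refine le_of_mul_le_mul_left ?_ h.pos
  linarith

/-- The axioms are inherited from the Euclidean distance; the constant is the product of `9 * √Q`
and `32 * Q`. -/
theorem isQuasiDistOn (h : IsPinched S N m Q) {c : ℝ} (hc : 288 * √Q * Q ≤ c) :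
    IsQuasiDistOn S (ReflectionDefined S N) (reflectionDist S N) c := by
  have hspec : ∀ {x y}, ReflectionDefined S N x y → IsReflection S N x y (reflection S N x y) := by
    intro x y hD
    rw [reflection, dif_pos hD]
    exact hD.choose_spec
  have hQ := h.one_le
  have hupp : ∀ x ∈ S, ∀ y ∈ S, ReflectionDefined S N x y →
      reflectionDist S N x y ≤ 9 * √Q * ‖x - y‖ := fun x hx y hy hD =>
    h.norm_sub_reflection_le hx hy (hspec hD)
  have hlow : ∀ x ∈ S, ∀ y ∈ S, ReflectionDefined S N x y →
      ‖x - y‖ ≤ 32 * Q * reflectionDist S N x y := fun x hx y hy hD =>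
    h.norm_sub_le_reflection hx hy (hspec hD)
  have hnn : ∀ x y, 0 ≤ reflectionDist S N x y := fun x y => norm_nonneg _
  have hsQ : 0 < √Q := Real.sqrt_pos.2 (by linarith)
  refine ⟨lt_of_lt_of_le (by positivity) hc, fun x _ y _ _ => hnn x y, ?_, ?_, ?_⟩
  · intro x hx y hy hD
    constructor
    · intro h0
      have := hlow x hx y hy hD
      rw [h0, mul_zero] at this
      exact sub_eq_zero.1 (norm_le_zero_iff.1 this)
    · rintro rfl
      have := hupp x hx x hy hD
      rw [sub_self, norm_zero, mul_zero] at this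
      exact le_antisymm this (hnn x x)
  · intro x hx y hy hxy hyx
    calc reflectionDist S N x y ≤ 9 * √Q * ‖x - y‖ := hupp x hx y hy hxy
      _ ≤ 9 * √Q * (32 * Q * reflectionDist S N y x) := by
        rw [norm_sub_rev]
        gcongr
        exact hlow y hy x hx hyx
      _ = 288 * √Q * Q * reflectionDist S N y x := by ring
      _ ≤ c * reflectionDist S N y x := mul_le_mul_of_nonneg_right hc (hnn _ _)
  · intro x hx y hy z hz hxy hxz hyz
    calc reflectionDist S N x y ≤ 9 * √Q * ‖x - y‖ := hupp x hx y hy hxy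
      _ ≤ 9 * √Q * (‖x - z‖ + ‖y - z‖) := by
        gcongr
        rw [norm_sub_rev y z]
        exact norm_sub_le_norm_sub_add_norm_sub x z y
      _ ≤ 9 * √Q * (32 * Q * reflectionDist S N x z + 32 * Q * reflectionDist S N y z) := by
        gcongr
        · exact hlow x hx z hz hxz
        · exact hlow y hy z hz hyz
      _ = 288 * √Q * Q * (reflectionDist S N x z + reflectionDist S N y z) := by ring
      _ ≤ c * (reflectionDist S N x z + reflectionDist S N y z) :=
        mul_le_mul_of_nonneg_right hc (add_nonneg (hnn _ _) (hnn _ _))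

end IsPinched

end Reflection

theorem proposition4p1 (n : ℕ) (hn : 2 ≤ n) :
    ∃ C : ℝ, 0 < C ∧ ∃ c : ℝ → ℝ,
      ∀ (S : Set (EuclideanSpace ℝ (Fin n)))
        (N : EuclideanSpace ℝ (Fin n) → EuclideanSpace ℝ (Fin n)),
        IsOrientedHypersurface S N →
        IsStrictlyConvexHypersurface S N →
        (∀ u ∈ S, ∀ u' ∈ S, 1 / 2 ≤ inner ℝ (N u) (N u')) →
        IsGraphOverConvex S N →
        (curvatureRatioBounds S N).Nonempty →
        (∀ u ∈ S, ∀ u' ∈ S, ∀ v ∈ S, ∀ w ∈ S,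
          IsReflection S N u u' v → IsReflection S N u u' w → v = w) ∧
        (∀ u ∈ S, ∀ u' ∈ S, ∀ u'' ∈ S, IsReflection S N u u' u'' →
          ‖u' - u''‖ ≤ C * curvatureQuotient S N ^ (1 / 2 : ℝ) * ‖u - u'‖ ∧
          C⁻¹ * (curvatureQuotient S N)⁻¹ * ‖u - u'‖ ≤ ‖u' - u''‖) ∧
        IsQuasiDistOn S (ReflectionDefined S N) (reflectionDist S N)
          (c (curvatureQuotient S N)) := by
  -- The summand `1` and `|q|` keep the constant positive for every real `q`, also for empty `S`,
  -- where the quotient carries no information.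
  refine ⟨32, by norm_num, fun q => 1 + 288 * √q * |q|, ?_⟩
  intro S N hS hconv hN hgr hQne
  have hcpos : 0 < 1 + 288 * √(curvatureQuotient S N) * |curvatureQuotient S N| := by positivity
  rcases S.eq_empty_or_nonempty with hempty | hne
  · refine ⟨fun u hu => ?_, fun u hu => ?_, hcpos, fun u hu => ?_, fun u hu => ?_, fun u hu => ?_,
      fun u hu => ?_⟩ <;> · rw [hempty] at hu; exact absurd hu (Set.notMem_empty u)
  obtain ⟨hQ, m, hm, hκ⟩ := exists_curvature_pinching hn hS hconv hQne hne
  set Q := curvatureQuotient S N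
  have hbd := fun u (hu : u ∈ S) v (hv : v ∈ S) =>
    hgr.height_bounds hS hm.le (by positivity : 0 ≤ Q * m) hκ hu hv
  have hp : IsPinched S N m Q :=
    { pos := hm
      one_le := hQ
      norm_eq_one := fun u hu => hS.norm_eq_one hu
      half_le_inner := hN
      le_height := fun u hu v hv => (hbd u hu v hv).1
      height_le := fun u hu v hv => (hbd u hu v hv).2.1
      lipschitz := fun u hu v hv => (hbd u hu v hv).2.2 }
  refine ⟨fun u hu u' hu' v _ w _ => hp.reflection_unique hu hu', ?_, hp.isQuasiDistOn ?_⟩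
  · intro u hu u' hu' u'' _ hR
    constructor
    · rw [← Real.sqrt_eq_rpow]
      refine (hp.norm_sub_reflection_le hu hu' hR).trans ?_
      gcongr
      norm_num
    · rw [← mul_inv, inv_mul_le_iff₀ (by positivity)]
      exact hp.norm_sub_le_reflection hu hu' hR
  · beta_reduce
    rw [abs_of_nonneg (by linarith)]
    linarith
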